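/- Let $\gamma=(1+\sqrt5)/2$ denote the golden ratio, and let the height of a polynomial in $\mathbb{Z}[T]$ be the largest absolute value of its coefficients. Let $\xi$ be a real number which is not algebraic over $\mathbb{Q}$ of degree at most $2$. Then there exists a constant $c>0$, depending only on $\xi$, such that there are arbitrarily large real numbers $Y\ge 1$ for which there exist an irreducible monic polynomial $P\in\mathbb{Z}[T]$ of degree $3$ and an irreducible polynomial $Q\in\mathbb{Z}[T]$ of degree $2$, both of height at most $Y$, each of which admits at least two distinct real roots whose distance to $\xi$ is at most $cY^{-(3-\gamma)/2}$. -/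

import Mathlib

open Polynomial

/-- At least two distinct real roots of `P` lie at
distance at most `δ` from `ξ`. -/
def HasTwoRealRootsNear (P : ℤ[X]) (ξ δ : ℝ) : Prop :=
  ∃ x y : ℝ, x ≠ y ∧ aeval x P = 0 ∧ aeval y P = 0 ∧ |x - ξ| ≤ δ ∧ |y - ξ| ≤ δ

/-- `ξ` is algebraic over `ℚ` of degree at most `n`. -/
def IsAlgebraicOfDegreeLE (ξ : ℝ) (n : ℕ) : Prop :=
  IsAlgebraic ℚ ξ ∧ (minpoly ℚ ξ).natDegree ≤ n

/-- The height of an integer polynomial: the largest absolute value of its coefficients. -/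
noncomputable def Polynomial.intHeight (P : ℤ[X]) : ℝ := P.supNorm

/-! The construction gives root distance `O(1 / Y)`, which suffices because `(3 - γ) / 2 < 1`. Since
`ξ` is irrational, `ℤ²` has bases `(a, b)`, `(a', b')` of size `Z` with `L = aT - b` and `L' = a'T -
b'` at most `1 / Z` at `ξ`. Then `L²`, `LL'`, `L'²` form a basis of the integer polynomials of
degree at most `2`. Rounding coordinates in it (`exists_int_quadratic_near`) prescribes value, slope
and leading coefficient up to `O(1 / Y)`, `O(1)`, `O(Y)`, where `Y = Z²`. This freedom survives
multiplication by `4`, so a class modulo `4` that is Eisenstein at `2` contains a polynomial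
slightly negative at `ξ` and so convex there that it is positive at `ξ ± 1 / Y`
(`exists_intCubic_hasTwoRealRootsNear`). -/

/-! ### Approximation by integer polynomials of degree at most 2 -/

/-- An irrational real number admits bases of `ℤ²` consisting of two good rational approximations,
at arbitrarily large scales. -/
theorem exists_unimodular_approximations {ξ : ℝ} (hξ : Irrational ξ) (N : ℕ) :
    ∃ (Z : ℝ) (a b a' b' : ℤ), (N : ℝ) ≤ Z ∧ 1 ≤ Z ∧ (a * b' - a' * b) ^ 2 = 1 ∧
      |(a : ℝ)| ≤ Z ∧ |(a' : ℝ)| ≤ Z ∧ |a * ξ - b| ≤ 1 / Z ∧ |a' * ξ - b'| ≤ 1 / Z := by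
  obtain ⟨q, hq, hqN⟩ := Real.exists_rat_abs_sub_le_and_den_le ξ (n := N + 1) (by omega)
  have hden : (0 : ℝ) < q.den := by exact_mod_cast q.den_pos
  have hnd : (q : ℝ) = q.num / q.den := by exact_mod_cast (Rat.num_div_den q).symm
  set l : ℝ := q.den * ξ - q.num with hl
  have hl_eq : l = q.den * (ξ - q) := by rw [hl, hnd]; field_simp
  have hl0 : l ≠ 0 := by
    rw [hl_eq]
    exact mul_ne_zero hden.ne' (sub_ne_zero.2 (hξ.ne_rat q))
  have hlpos : 0 < |l| := abs_pos.2 hl0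
  have hl_le : |l| * (N + 2) ≤ 1 := by
    rw [hl_eq, abs_mul, abs_of_pos hden]
    rw [le_div_iff₀ (by positivity)] at hq
    push_cast at hq
    linarith
  have hqN' : (q.den : ℝ) ≤ N + 1 := by exact_mod_cast hqN
  have hZ : (N : ℝ) + 2 ≤ 1 / |l| := by rw [le_div_iff₀ hlpos]; linarith
  have hN : (0 : ℝ) ≤ N := N.cast_nonneg
  obtain ⟨s, t, hst⟩ : IsCoprime q.num (q.den : ℤ) := by
    rw [Int.isCoprime_iff_gcd_eq_one]
    simpa [Int.gcd] using q.reduced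
  -- The determinant is given the sign of `l`, so that the two terms of `a' * |l| - 1` below partly
  -- cancel.
  obtain ⟨ε, hε, hεl⟩ : ∃ ε : ℤ, ε ^ 2 = 1 ∧ (ε : ℝ) * |l| = l := by
    rcases lt_or_gt_of_ne hl0 with h | h
    · exact ⟨-1, by norm_num, by rw [abs_of_neg h]; push_cast; ring⟩
    · exact ⟨1, by norm_num, by rw [abs_of_pos h]; push_cast; ring⟩
  have hεR : (ε : ℝ) ^ 2 = 1 := by exact_mod_cast hε
  -- This makes `a'` the largest element of its class modulo `q.den` not exceeding `1 / |l|`.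
  set k : ℤ := ⌊(1 / |l| + ε * s) / q.den⌋ with hk
  set a' : ℤ := -ε * s + k * q.den with ha'
  set b' : ℤ := ε * t + k * q.num with hb'
  have hdet : (q.den : ℤ) * b' - a' * q.num = ε := by
    rw [ha', hb']; linear_combination ε * hst
  have hk1 : (k : ℝ) * q.den ≤ 1 / |l| + ε * s := by
    rw [← le_div_iff₀ hden]; exact Int.floor_le _
  have hk2 : 1 / |l| + ε * s < (k + 1) * q.den := by
    rw [← div_lt_iff₀ hden]; exact Int.lt_floor_add_one _
  have ha'R : (a' : ℝ) = -ε * s + k * q.den := by rw [ha']; push_cast; ring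
  have h1 : (a' : ℝ) ≤ 1 / |l| := by linarith
  have h2 : 1 / |l| - q.den < a' := by linarith
  have h3 : (q.den : ℝ) * (a' * ξ - b') = ε * (a' * |l| - 1) := by
    have : (q.den : ℝ) * b' - a' * q.num = ε := by exact_mod_cast hdet
    linear_combination (-1 : ℝ) * this - (a' : ℝ) * hεl
  have hεabs : |(ε : ℝ)| = 1 := by
    rw [← sq_eq_sq₀ (abs_nonneg _) zero_le_one, sq_abs, hεR]; norm_num
  refine ⟨1 / |l|, q.den, q.num, a', b', by linarith, by linarith, by rw [hdet, hε], ?_, ?_, ?_, ?_⟩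
  · rw [Int.cast_natCast, abs_of_pos hden]; linarith
  · rw [abs_of_pos (by linarith)]; exact h1
  · rw [Int.cast_natCast, one_div_one_div]
  · rw [one_div_one_div]
    have h4 : q.den * |a' * ξ - b'| = |a' * |l| - 1| := by
      have := congrArg abs h3
      rwa [abs_mul, abs_mul, hεabs, one_mul, abs_of_pos hden] at this
    have h5 : (a' : ℝ) * |l| ≤ 1 := by rwa [← le_div_iff₀ hlpos]
    have h6 : 1 - q.den * |l| < a' * |l| := by
      have := mul_lt_mul_of_pos_right h2 hlpos
      rwa [sub_mul, one_div_mul_cancel hlpos.ne'] at this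
    rw [abs_of_nonpos (by linarith : a' * |l| - 1 ≤ 0)] at h4
    exact le_of_mul_le_mul_left (by linarith) hden

/-- At arbitrarily large scales `Y`, each real polynomial of degree at most `2` is close, in terms
of Taylor coefficients at `ξ`, to an integer polynomial. -/
theorem exists_int_quadratic_near {ξ : ℝ} (hξ : Irrational ξ) (Y₀ : ℝ) :
    ∃ Y : ℝ, Y₀ ≤ Y ∧ 1 ≤ Y ∧ ∀ r₀ r₁ r₂ : ℝ, ∃ u₀ u₁ u₂ : ℤ,
      |u₀ + u₁ * ξ + u₂ * ξ ^ 2 - r₀| ≤ 3 / 2 / Y ∧ |u₁ + 2 * u₂ * ξ - r₁| ≤ 3 ∧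
        |u₂ - r₂| ≤ 3 / 2 * Y := by
  obtain ⟨N, hN⟩ := exists_nat_ge Y₀
  obtain ⟨Z, a, b, a', b', hNZ, hZ, hdet, ha, ha', hl, hl'⟩ := exists_unimodular_approximations hξ N
  have hZ0 : 0 < Z := by linarith
  refine ⟨Z ^ 2, by nlinarith, by nlinarith, fun r₀ r₁ r₂ => ?_⟩
  have hdetR : ((a : ℝ) * b' - a' * b) ^ 2 = 1 := by exact_mod_cast hdet
  have herr (x y z A B C M : ℝ) (hA : |A| ≤ M) (hB : |B| ≤ M) (hC : |C| ≤ M) :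
      |(round x - x) * A + (round y - y) * B + (round z - z) * C| ≤ 3 / 2 * M := by
    have hr (x A : ℝ) (hA : |A| ≤ M) : |(round x - x) * A| ≤ 1 / 2 * M := by
      rw [abs_mul, abs_sub_comm]
      exact mul_le_mul (abs_sub_round x) hA (abs_nonneg _) (by norm_num)
    have := abs_add_three ((round x - x) * A) ((round y - y) * B) ((round z - z) * C)
    linarith [hr x A hA, hr y B hB, hr z C hC]
  have hprod {x y M K : ℝ} (hx : |x| ≤ M) (hy : |y| ≤ K) : |x * y| ≤ M * K := by
    rw [abs_mul]
    exact mul_le_mul hx hy (abs_nonneg _) ((abs_nonneg _).trans hx)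
  have hsum {x y M K : ℝ} (hx : |x| ≤ M) (hy : |y| ≤ K) : |x + y| ≤ M + K :=
    (abs_add_le x y).trans (add_le_add hx hy)
  set l : ℝ := a * ξ - b with hl_def
  set l' : ℝ := a' * ξ - b' with hl'_def
  set p₁ : ℝ := r₁ - 2 * r₂ * ξ with hp₁
  set p₀ : ℝ := r₀ - p₁ * ξ - r₂ * ξ ^ 2 with hp₀
  -- Coordinates of the target `p₀ + p₁T + r₂T²` in the basis `L²`, `LL'`, `L'²`; there is no
  -- denominator because the determinant squares to `1`.
  set x : ℝ := p₀ * a' ^ 2 + p₁ * (a' * b') + r₂ * b' ^ 2 with hx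
  set y : ℝ := -(2 * p₀ * (a * a') + p₁ * (a * b' + a' * b) + 2 * r₂ * (b * b')) with hy
  set z : ℝ := p₀ * a ^ 2 + p₁ * (a * b) + r₂ * b ^ 2 with hz
  have e0 : x * b ^ 2 + y * (b * b') + z * b' ^ 2 = p₀ := by
    linear_combination p₀ * hdetR
  have e1 : -(2 * x * (a * b) + y * (a * b' + a' * b) + 2 * z * (a' * b')) = p₁ := by
    linear_combination p₁ * hdetR
  have e2 : x * a ^ 2 + y * (a * a') + z * a' ^ 2 = r₂ := by
    linear_combination r₂ * hdetR
  refine ⟨round x * b ^ 2 + round y * (b * b') + round z * b' ^ 2,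
    -(2 * round x * (a * b) + round y * (a * b' + a' * b) + 2 * round z * (a' * b')),
    round x * a ^ 2 + round y * (a * a') + round z * a' ^ 2, ?_, ?_, ?_⟩
  · convert herr x y z (l * l) (l * l') (l' * l') _ (hprod hl hl) (hprod hl hl') (hprod hl' hl')
      using 1
    · push_cast
      congr 1
      rw [hl_def, hl'_def]
      linear_combination e0 + ξ * e1 + ξ ^ 2 * e2
    · field_simp
  · convert herr x y z (l * a + l * a) (l * a' + l' * a) (l' * a' + l' * a') _
      (hsum (hprod hl ha) (hprod hl ha)) (hsum (hprod hl ha') (hprod hl' ha))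
      (hsum (hprod hl' ha') (hprod hl' ha')) using 1
    · push_cast
      congr 1
      rw [hl_def, hl'_def]
      linear_combination e1 + 2 * ξ * e2
    · field_simp; norm_num
  · convert herr x y z (a * a) (a * a') (a' * a') _ (hprod ha ha) (hprod ha ha') (hprod ha' ha')
      using 1
    · push_cast
      congr 1
      linear_combination e2
    · ring

/-! ### Irrationality, heights, irreducibility and real roots -/

theorem irrational_of_not_isAlgebraicOfDegreeLE {ξ : ℝ} {n : ℕ} (hn : 1 ≤ n)
    (hξ : ¬ IsAlgebraicOfDegreeLE ξ n) : Irrational ξ := by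
  rintro ⟨q, rfl⟩
  refine hξ ⟨isAlgebraic_algebraMap q, ?_⟩
  have : minpoly ℚ (q : ℝ) = X - C q := minpoly.eq_X_sub_C ℝ q
  rwa [this, natDegree_X_sub_C]

/-- The integer polynomial `a₃T³ + a₂T² + a₁T + a₀`. -/
noncomputable def intCubic (a₃ a₂ a₁ a₀ : ℤ) : ℤ[X] := C a₃ * X ^ 3 + C a₂ * X ^ 2 + C a₁ * X + C a₀

theorem aeval_intCubic (a₃ a₂ a₁ a₀ : ℤ) (x : ℝ) :
    aeval x (intCubic a₃ a₂ a₁ a₀) = a₃ * x ^ 3 + a₂ * x ^ 2 + a₁ * x + a₀ := by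
  simp [intCubic]

theorem coeff_intCubic (a₃ a₂ a₁ a₀ : ℤ) (i : ℕ) :
    (intCubic a₃ a₂ a₁ a₀).coeff i = (if i = 3 then a₃ else 0) + (if i = 2 then a₂ else 0) +
      (if i = 1 then a₁ else 0) + (if i = 0 then a₀ else 0) := by
  simp only [intCubic, coeff_add, coeff_C_mul, coeff_X_pow, coeff_X, coeff_C, mul_ite, mul_one,
    mul_zero, eq_comm (a := 1)]

theorem intHeight_intCubic_le {a₃ a₂ a₁ a₀ : ℤ} {H : ℝ} (h₃ : |(a₃ : ℝ)| ≤ H) (h₂ : |(a₂ : ℝ)| ≤ H)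
    (h₁ : |(a₁ : ℝ)| ≤ H) (h₀ : |(a₀ : ℝ)| ≤ H) : (intCubic a₃ a₂ a₁ a₀).intHeight ≤ H := by
  obtain ⟨i, hi⟩ := (intCubic a₃ a₂ a₁ a₀).exists_eq_supNorm
  rw [intHeight, hi, Int.norm_eq_abs]
  rcases i with _ | _ | _ | _ | i
  · simpa [coeff_intCubic] using h₀
  · simpa [coeff_intCubic] using h₁
  · simpa [coeff_intCubic] using h₂
  · simpa [coeff_intCubic] using h₃
  · simpa [coeff_intCubic] using (abs_nonneg _).trans h₀

theorem intHeight_primPart_le {P : ℤ[X]} (hP : P ≠ 0) : P.primPart.intHeight ≤ P.intHeight := by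
  obtain ⟨i, hi⟩ := P.primPart.exists_eq_supNorm
  rw [intHeight, hi]
  refine le_trans ?_ (P.le_supNorm i)
  conv_rhs => rw [P.eq_C_content_mul_primPart, coeff_C_mul, norm_mul]
  refine le_mul_of_one_le_left (norm_nonneg _) ?_
  rw [Int.norm_eq_abs]
  exact_mod_cast Int.one_le_abs (content_eq_zero_iff.not.2 hP)

/-- A polynomial satisfying the conditions of Eisenstein's criterion at `2` has irreducible
primitive part. -/
theorem irreducible_primPart_of_eisenstein_two {P : ℤ[X]} {n : ℕ} (hn : 0 < n)
    (hdeg : P.natDegree = n) (hlead : ¬ 2 ∣ P.coeff n) (h : ∀ i < n, 2 ∣ P.coeff i)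
    (h0 : ¬ 4 ∣ P.coeff 0) : Irreducible P.primPart := by
  have hcoeff (i : ℕ) : P.coeff i = P.content * P.primPart.coeff i := by
    conv_lhs => rw [P.eq_C_content_mul_primPart, coeff_C_mul]
  have hc : ¬ (2 : ℤ) ∣ P.content := fun hd => hlead (hd.trans (P.content_dvd_coeff n))
  have hdeg' : P.primPart.natDegree = n := by rw [natDegree_primPart, hdeg]
  have hne : P.primPart ≠ 0 := P.primPart_ne_zero
  have h2 : Prime (2 : ℤ) := Int.prime_two
  refine irreducible_of_eisenstein_criterion (P := Ideal.span {(2 : ℤ)})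
    ((Ideal.span_singleton_prime two_ne_zero).2 h2) ?_ (fun i hi => ?_) ?_ ?_ P.isPrimitive_primPart
  · rw [Ideal.mem_span_singleton, leadingCoeff, hdeg']
    exact fun hd => hlead (by rw [hcoeff]; exact hd.mul_left _)
  · rw [degree_eq_natDegree hne, hdeg', Nat.cast_lt] at hi
    have := h i hi
    rw [hcoeff] at this
    exact Ideal.mem_span_singleton.2 ((h2.dvd_or_dvd this).resolve_left hc)
  · rw [degree_eq_natDegree hne, hdeg']; exact_mod_cast hn
  · rw [Ideal.span_singleton_pow, Ideal.mem_span_singleton]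
    exact fun hd => h0 (by rw [hcoeff]; exact Dvd.dvd.mul_left (by simpa using hd) _)

theorem HasTwoRealRootsNear.primPart {P : ℤ[X]} (hP : P ≠ 0) {ξ δ : ℝ}
    (h : HasTwoRealRootsNear P ξ δ) : HasTwoRealRootsNear P.primPart ξ δ := by
  have key {x : ℝ} (hx : aeval x P = 0) : aeval x P.primPart = 0 := by
    rw [P.eq_C_content_mul_primPart, map_mul, aeval_C] at hx
    refine (mul_eq_zero.1 hx).resolve_left ?_
    simpa [content_eq_zero_iff] using hP
  obtain ⟨x, y, hxy, hx, hy, hx', hy'⟩ := h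
  exact ⟨x, y, hxy, key hx, key hy, hx', hy'⟩

theorem hasTwoRealRootsNear_of_sign_changes {P : ℤ[X]} {ξ δ : ℝ} (hδ : 0 ≤ δ)
    (hl : 0 < aeval (ξ - δ) P) (hm : aeval ξ P < 0) (hr : 0 < aeval (ξ + δ) P) :
    HasTwoRealRootsNear P ξ δ := by
  have hc : Continuous fun x : ℝ => aeval x P := P.continuous_aeval
  obtain ⟨x, hx, hx0⟩ := intermediate_value_Icc' (by linarith : ξ - δ ≤ ξ) hc.continuousOn
    (show (0 : ℝ) ∈ Set.Icc _ _ from ⟨hm.le, hl.le⟩)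
  obtain ⟨y, hy, hy0⟩ := intermediate_value_Icc (by linarith : ξ ≤ ξ + δ) hc.continuousOn
    (show (0 : ℝ) ∈ Set.Icc _ _ from ⟨hm.le, hr.le⟩)
  refine ⟨x, y, ?_, hx0, hy0, ?_, ?_⟩
  · rintro rfl
    have : x = ξ := le_antisymm hx.2 hy.1
    subst this
    exact hm.ne hx0
  · rw [abs_le]; constructor <;> linarith [hx.1, hx.2]
  · rw [abs_le]; constructor <;> linarith [hy.1, hy.2]

/-! ### Polynomials with two roots near `ξ` in a class modulo 4 -/

/-- At arbitrarily large scales `Y`, the class modulo `4` of `tT³ + mT² + 2`, with `t` prescribed,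
contains a polynomial of height `O(Y)` with two real roots at distance at most `1 / Y` from `ξ`. -/
theorem exists_intCubic_hasTwoRealRootsNear {ξ : ℝ} (hξ : Irrational ξ) (Y₀ : ℝ) :
    ∃ Y : ℝ, Y₀ ≤ Y ∧ 1 ≤ Y ∧ ∀ t m : ℤ, 0 ≤ t → t ≤ 1 → ∃ u₀ u₁ u₂ : ℤ,
      HasTwoRealRootsNear (intCubic t (m + 4 * u₂) (4 * u₁) (2 + 4 * u₀)) ξ (1 / Y) ∧
      (intCubic t (m + 4 * u₂) (4 * u₁) (2 + 4 * u₀)).intHeight ≤ 93 * (1 + |ξ|) ^ 3 * Y := by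
  obtain ⟨Y, hY₀, hY, happrox⟩ := exists_int_quadratic_near hξ Y₀
  refine ⟨Y, hY₀, hY, fun t m ht0 ht1 => ?_⟩
  -- After multiplication by `4` the errors are `6 / Y`, `12`, `6Y`. The targets `-7 / Y`, `0`,
  -- `33Y` keep the value at `ξ` in `[-13 / Y, -1 / Y]`, and at `ξ ± 1 / Y` it is at least `(27 - 13
  -- - 12 - 1) / Y > 0`.
  obtain ⟨u₀, u₁, u₂, h0, h1, h2⟩ := happrox
    ((-7 / Y - (2 + m * ξ ^ 2 + t * ξ ^ 3)) / 4) (-(2 * m * ξ + 3 * t * ξ ^ 2) / 4)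
    ((33 * Y - m - 3 * t * ξ) / 4)
  refine ⟨u₀, u₁, u₂, ?_⟩
  have hY0 : 0 < Y := by linarith
  have ht0' : (0 : ℝ) ≤ t := by exact_mod_cast ht0
  have ht1' : (t : ℝ) ≤ 1 := by exact_mod_cast ht1
  obtain ⟨w₀, hw₀⟩ : ∃ w : ℝ, w =
    (2 + 4 * u₀) + 4 * u₁ * ξ + (m + 4 * u₂) * ξ ^ 2 + t * ξ ^ 3 := ⟨_, rfl⟩
  obtain ⟨w₁, hw₁⟩ : ∃ w : ℝ, w =
    4 * u₁ + 2 * (m + 4 * u₂) * ξ + 3 * t * ξ ^ 2 := ⟨_, rfl⟩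
  obtain ⟨w₂, hw₂⟩ : ∃ w : ℝ, w = (m + 4 * u₂) + 3 * t * ξ := ⟨_, rfl⟩
  obtain ⟨d, hd⟩ : ∃ d : ℝ, d = 1 / Y := ⟨_, rfl⟩
  have hdY : d * Y = 1 := by rw [hd]; exact one_div_mul_cancel hY0.ne'
  have hd0 : 0 < d := by rw [hd]; positivity
  have hd1 : d ≤ 1 := by rw [hd]; exact (div_le_one hY0).2 hY
  rw [show (-7 / Y : ℝ) = -7 * d by rw [hd]; ring, show 3 / 2 / Y = 3 / 2 * d by rw [hd]; ring,
    abs_le] at h0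
  rw [abs_le] at h1 h2
  have b0 : -(13 * d) ≤ w₀ ∧ w₀ ≤ -d := by constructor <;> rw [hw₀] <;> linarith [h0.1, h0.2]
  have b1 : |w₁| ≤ 12 := by rw [hw₁, abs_le]; constructor <;> linarith [h1.1, h1.2]
  have b2 : 27 * Y ≤ w₂ ∧ w₂ ≤ 39 * Y := by
    constructor <;> rw [hw₂] <;> linarith [h2.1, h2.2]
  have hev (s : ℝ) : aeval (ξ + s) (intCubic t (m + 4 * u₂) (4 * u₁) (2 + 4 * u₀)) =
      w₀ + w₁ * s + w₂ * s ^ 2 + t * s ^ 3 := by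
    rw [aeval_intCubic, hw₀, hw₁, hw₂]; push_cast; ring
  have b2d : 27 * d ≤ w₂ * d ^ 2 := by
    have := mul_le_mul_of_nonneg_right b2.1 (sq_nonneg d)
    calc 27 * d = 27 * Y * d ^ 2 := by linear_combination (-27 * d) * hdY
      _ ≤ _ := this
  have b3d : 0 ≤ t * d ^ 3 ∧ t * d ^ 3 ≤ d := by
    refine ⟨by positivity, ?_⟩
    calc t * d ^ 3 ≤ 1 * d ^ 1 :=
          mul_le_mul ht1' (pow_le_pow_of_le_one hd0.le hd1 (by norm_num)) (by positivity) (by norm_num)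
      _ = d := by ring
  have b1d : -(12 * d) ≤ w₁ * d ∧ w₁ * d ≤ 12 * d := by
    rw [abs_le] at b1
    constructor <;> nlinarith [b1.1, b1.2]
  constructor
  · rw [← hd]
    refine hasTwoRealRootsNear_of_sign_changes hd0.le ?_ ?_ ?_
    · rw [sub_eq_add_neg, hev]; nlinarith
    · have := hev 0
      rw [add_zero] at this
      rw [this]; linarith [b0.2]
    · rw [hev]; linarith [b0.1, b1d.1, b3d.1]
  · obtain ⟨A, hA⟩ : ∃ A : ℝ, A = 1 + |ξ| := ⟨_, rfl⟩
    have hA1 : 1 ≤ A := by rw [hA]; linarith [abs_nonneg ξ]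
    have hξA : |ξ| ≤ A := by rw [hA]; linarith
    have c0 : |w₀| ≤ 13 * Y := by rw [abs_le]; constructor <;> linarith [b0.1, b0.2]
    have c1 : |w₁| ≤ 12 * Y := by linarith
    have c2 : |w₂| ≤ 39 * Y := by rw [abs_le]; constructor <;> linarith [b2.1, b2.2]
    have c3 : |(t : ℝ)| ≤ 1 * Y := by rw [abs_of_nonneg ht0']; linarith
    have hterm {w K : ℝ} (n : ℕ) (hn : n ≤ 3) (hw : |w| ≤ K * Y) :
        |w * ξ ^ n| ≤ K * (A ^ 3 * Y) := by
      have hK : 0 ≤ K * Y := (abs_nonneg _).trans hw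
      calc |w * ξ ^ n| = |w| * |ξ| ^ n := by rw [abs_mul, abs_pow]
        _ ≤ K * Y * A ^ 3 := mul_le_mul hw ((pow_le_pow_left₀ (abs_nonneg _) hξA n).trans
            (pow_le_pow_right₀ hA1 hn)) (by positivity) hK
        _ = K * (A ^ 3 * Y) := by ring
    have hM : 0 ≤ A ^ 3 * Y := by positivity
    rw [← hA, mul_assoc]
    have t00 := abs_le.1 (hterm 0 (by norm_num) c0)
    have t11 := abs_le.1 (hterm 1 (by norm_num) c1)
    have t22 := abs_le.1 (hterm 2 (by norm_num) c2)
    have t33 := abs_le.1 (hterm 3 (by norm_num) c3)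
    have t10 := abs_le.1 (hterm 0 (by norm_num) c1)
    have t21 := abs_le.1 (hterm 1 (by norm_num) c2)
    have t32 := abs_le.1 (hterm 2 (by norm_num) c3)
    have t20 := abs_le.1 (hterm 0 (by norm_num) c2)
    have t31 := abs_le.1 (hterm 1 (by norm_num) c3)
    have t30 := abs_le.1 (hterm 0 (by norm_num) c3)
    rw [pow_zero, mul_one] at t00 t10 t20 t30
    have g2 : (m + 4 * u₂ : ℝ) = w₂ - 3 * (t * ξ ^ 1) := by rw [hw₂]; ring
    -- The largest bound comes from this coefficient: `93 = 12 + 2 * 39 + 3 * 1`.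
    have g1 : (4 * u₁ : ℝ) = w₁ - 2 * (w₂ * ξ ^ 1) + 3 * (t * ξ ^ 2) := by rw [hw₁, hw₂]; ring
    have g0 : (2 + 4 * u₀ : ℝ) = w₀ - w₁ * ξ ^ 1 + w₂ * ξ ^ 2 - t * ξ ^ 3 := by
      rw [hw₀, hw₁, hw₂]; ring
    apply intHeight_intCubic_le
    · rw [abs_le]; constructor <;> linarith [t30.1, t30.2]
    · push_cast; rw [g2, abs_le]; constructor <;> linarith [t20.1, t20.2, t31.1, t31.2]
    · push_cast; rw [g1, abs_le]
      constructor <;> linarith [t10.1, t10.2, t21.1, t21.2, t32.1, t32.2]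
    · push_cast; rw [g0, abs_le]
      constructor <;> linarith [t00.1, t00.2, t11.1, t11.2, t22.1, t22.2, t33.1, t33.2]

/-! ### Deduction of the theorem -/

theorem HasTwoRealRootsNear.mono {P : ℤ[X]} {ξ δ δ' : ℝ} (h : HasTwoRealRootsNear P ξ δ)
    (hδ : δ ≤ δ') : HasTwoRealRootsNear P ξ δ' := by
  obtain ⟨x, y, hxy, hx, hy, hx', hy'⟩ := h
  exact ⟨x, y, hxy, hx, hy, hx'.trans hδ, hy'.trans hδ⟩

theorem natDegree_intCubic {a₃ : ℤ} (h : a₃ ≠ 0) (a₂ a₁ a₀ : ℤ) :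
    (intCubic a₃ a₂ a₁ a₀).natDegree = 3 :=
  natDegree_cubic h

theorem natDegree_intCubic_zero {a₂ : ℤ} (h : a₂ ≠ 0) (a₁ a₀ : ℤ) :
    (intCubic 0 a₂ a₁ a₀).natDegree = 2 := by
  rw [intCubic, C_0, zero_mul, zero_add]
  exact natDegree_quadratic h

theorem mainTheorem2 (ξ : ℝ) (hξ : ¬ IsAlgebraicOfDegreeLE ξ 2) :
    ∃ c : ℝ, 0 < c ∧ ∀ Y₀ : ℝ, ∃ Y : ℝ, Y₀ ≤ Y ∧ 1 ≤ Y ∧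
      (∃ P : ℤ[X], Irreducible P ∧ P.Monic ∧ P.natDegree = 3 ∧ P.intHeight ≤ Y ∧
        HasTwoRealRootsNear P ξ (c * Y ^ (-((3 - Real.goldenRatio) / 2)))) ∧
      (∃ Q : ℤ[X], Irreducible Q ∧ Q.natDegree = 2 ∧ Q.intHeight ≤ Y ∧
        HasTwoRealRootsNear Q ξ (c * Y ^ (-((3 - Real.goldenRatio) / 2)))) := by
  have hirr := irrational_of_not_isAlgebraicOfDegreeLE one_le_two hξ
  obtain ⟨K, hK⟩ : ∃ K : ℝ, K = 93 * (1 + |ξ|) ^ 3 := ⟨_, rfl⟩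
  have hK1 : 1 ≤ K := by
    have : 1 ≤ (1 + |ξ|) ^ 3 := one_le_pow₀ (by linarith [abs_nonneg ξ])
    linarith
  refine ⟨K, by linarith, fun Y₀ => ?_⟩
  obtain ⟨Y, hY₀, hY, h⟩ := exists_intCubic_hasTwoRealRootsNear hirr Y₀
  rw [← hK] at h
  have hYK : Y ≤ K * Y := le_mul_of_one_le_left (by linarith) hK1
  have hδ : 1 / Y ≤ K * (K * Y) ^ (-((3 - Real.goldenRatio) / 2)) := by
    have h1 : (K * Y) ^ (-1 : ℝ) ≤ (K * Y) ^ (-((3 - Real.goldenRatio) / 2)) :=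
      Real.rpow_le_rpow_of_exponent_le (by linarith) (by linarith [Real.one_lt_goldenRatio])
    calc 1 / Y = K * (K * Y) ^ (-1 : ℝ) := by rw [Real.rpow_neg_one]; field_simp
      _ ≤ _ := mul_le_mul_of_nonneg_left h1 (by linarith)
  refine ⟨K * Y, by linarith, by linarith, ?_, ?_⟩
  · obtain ⟨u₀, u₁, u₂, hroots, hheight⟩ := h 1 0 zero_le_one le_rfl
    have hdeg := natDegree_intCubic one_ne_zero (0 + 4 * u₂) (4 * u₁) (2 + 4 * u₀)
    have hmonic : (intCubic 1 (0 + 4 * u₂) (4 * u₁) (2 + 4 * u₀)).Monic := by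
      rw [Monic, leadingCoeff, hdeg]; simp [coeff_intCubic]
    refine ⟨_, ?_, hmonic, hdeg, hheight, hroots.mono hδ⟩
    rw [← hmonic.isPrimitive.primPart_eq]
    refine irreducible_primPart_of_eisenstein_two three_pos hdeg ?_ (fun i hi => ?_) ?_
    · simp [coeff_intCubic]
    · interval_cases i <;> simp [coeff_intCubic] <;> omega
    · simp [coeff_intCubic]
  -- The quadratic may have a nontrivial (odd) content, so `Q` is its primitive part.
  · obtain ⟨u₀, u₁, u₂, hroots, hheight⟩ := h 0 1 le_rfl zero_le_one
    have hdeg := natDegree_intCubic_zero (show 1 + 4 * u₂ ≠ 0 by omega) (4 * u₁) (2 + 4 * u₀)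
    have hne : intCubic 0 (1 + 4 * u₂) (4 * u₁) (2 + 4 * u₀) ≠ 0 :=
      ne_zero_of_natDegree_gt (n := 0) (by omega)
    refine ⟨_, ?_, by rw [natDegree_primPart, hdeg], (intHeight_primPart_le hne).trans hheight,
      (hroots.primPart hne).mono hδ⟩
    refine irreducible_primPart_of_eisenstein_two two_pos hdeg ?_ (fun i hi => ?_) ?_
    · simp [coeff_intCubic]; omega
    · interval_cases i <;> simp [coeff_intCubic] <;> omega
    · simp [coeff_intCubic]
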